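/- Let $n\ge 1$ be an integer and $\hat c$ a real number, and put $$w_1(x)=e^{-n(x^2+\hat c x)},\qquad w_2(x)=e^{-nx^2},\qquad w_3(x)=e^{-n(x^2-\hat c x)}\qquad(x\in\mathbb R).$$ The (scaled) multiple Hermite polynomial for these weights is the monic polynomial $P$ of degree $3n$ with $\int_{-\infty}^{\infty}x^iP(x)w_j(x)\,dx=0$ for $0\le i\le n-1$ and $j=1,2,3$. There is a constant $C$ (independent of $n$) such that for all $\hat c>C$ and all $n\ge 1$ the following holds. The polynomial $P$ exists and is unique, and it has $3n$ distinct real zeros $x_{1,3n}<x_{2,3n}<\dots<x_{3n,3n}$. Let $\lambda^{(2)}_{k,3n}$, $1\le k\le 3n$, be the weights of the interpolatory quadrature rule at these nodes for $w_2$, that is, $$\lambda^{(2)}_{k,3n}=\int_{-\infty}^{\infty}\ell_k(x)\,e^{-nx^2}\,dx,\qquad \ell_k(x)=\prod_{i\ne k}\frac{x-x_{i,3n}}{x_{k,3n}-x_{i,3n}}.$$ This rule satisfies $$\int_{-\infty}^{\infty}f(x)e^{-nx^2}\,dx=\sum_{k=1}^{3n}\lambda^{(2)}_{k,3n}f(x_{k,3n})\qquad\text{for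 every real polynomial } f \text{ of degree at most } 4n-1,$$ and its weights satisfy $$\lambda^{(2)}_{k,3n}>0\qquad(n+1\le k\le 2n),$$ $$\operatorname{sign}\lambda^{(2)}_{k,3n}=(-1)^{k-n}\qquad(1\le k\le n),\qquad \operatorname{sign}\lambda^{(2)}_{k,3n}=(-1)^{k+1}\qquad(2n+1\le k\le 3n).$$ -/

import Mathlib

open Polynomial MeasureTheory

/-- `P` is the type II multiple orthogonal polynomial on `ℝ` for the weight functions
`w 0, …, w (r - 1)` and the multi-index `m`: it is monic of degree `m 0 + ⋯ + m (r - 1)`, and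
`∫ t ^ i * P t * w j t dt = 0` for `0 ≤ i ≤ m j - 1` and every `j`. (To be used for weights with
finite moments.) -/
def IsTypeIIMultipleOrthogonal {r : ℕ} (w : Fin r → ℝ → ℝ) (m : Fin r → ℕ) (P : ℝ[X]) : Prop :=
  P.Monic ∧ P.natDegree = ∑ j, m j ∧
    ∀ j : Fin r, ∀ i < m j, ∫ t : ℝ, t ^ i * P.eval t * w j t = 0

/-- The three scaled Hermite weights
`e^{-n(t² + ct)}`, `e^{-nt²}`, `e^{-n(t² - ct)}`. -/
noncomputable def scaledHermiteWeight (n : ℕ) (c : ℝ) : Fin 3 → ℝ → ℝ :=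
  ![fun t => Real.exp (-(n : ℝ) * (t ^ 2 + c * t)),
    fun t => Real.exp (-(n : ℝ) * t ^ 2),
    fun t => Real.exp (-(n : ℝ) * (t ^ 2 - c * t))]

/-- `x 1 < x 2 < ⋯ < x N` are exactly the real zeros of `P`. -/
def IsIncreasingZeros (P : ℝ[X]) (N : ℕ) (x : ℕ → ℝ) : Prop :=
  StrictMonoOn x (Set.Icc 1 N) ∧ ∀ t : ℝ, P.IsRoot t ↔ ∃ k ∈ Set.Icc 1 N, x k = t

/-- The `k`-th weight of the interpolatory quadrature rule with nodes `x 1, …, x N` for the weight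
function `w`, i.e. the integral against `w` of the `k`-th Lagrange basis polynomial. -/
noncomputable def quadratureWeight (w : ℝ → ℝ) (N : ℕ) (x : ℕ → ℝ) (k : ℕ) : ℝ :=
  ∫ t : ℝ, (Lagrange.basis (Finset.Icc 1 N) x k).eval t * w t

/-! Everything rests on a positivity principle: a nonzero polynomial of degree less than `4n` that
is nonnegative on `[-2, 2]` has positive integral against `e^{-n t²}`
(`gaussianMoment_pos_of_nonneg_Icc`). Gauss quadrature at the `2n` Hermite zeros is exact for such
polynomials, has positive weights, and has all its nodes in `(-2, 2)`.

Completing the square carries this over to windows of radius 2 about the centers `-c/2, 0, c/2`. If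
`P` had fewer than `n` sign changes in a window, its product with the corresponding linear factors
would have degree less than `4n` and constant sign there, against orthogonality. For `c > 8` the
windows are disjoint, so `P` has `n` zeros in each; the same count gives existence and uniqueness.

Exactness up to degree `4n - 1` follows by division by `P`. For the sign of the `k`-th weight, take
a test polynomial vanishing at the other nodes, with simple factors at outer nodes and squared
factors at middle ones. It is nonnegative on `[-2, 2]`, so its integral, which is the weight times
its value at `x k`, is positive. -/

/-! ### Gaussian moments of polynomials. -/

theorem integrable_eval_mul_exp_neg_mul_sq {b : ℝ} (hb : 0 < b) (f : ℝ[X]) :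
    Integrable fun t : ℝ => f.eval t * Real.exp (-b * t ^ 2) := by
  induction f using Polynomial.induction_on' with
  | add p q hp hq =>
    refine (hp.add hq).congr (Filter.Eventually.of_forall fun t => ?_)
    simp [add_mul]
  | monomial k a =>
    have h := (integrable_rpow_mul_exp_neg_mul_sq hb (s := (k : ℝ))
      (by have := k.cast_nonneg (α := ℝ); linarith)).const_mul a
    refine h.congr (Filter.Eventually.of_forall fun t => ?_)
    simp [mul_assoc]

/-- Integration of polynomials against the weight `e^{-b t²}`. -/
noncomputable def gaussianMoment {b : ℝ} (hb : 0 < b) : ℝ[X] →ₗ[ℝ] ℝ where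
  toFun f := ∫ t : ℝ, f.eval t * Real.exp (-b * t ^ 2)
  map_add' f g := by
    rw [← integral_add (integrable_eval_mul_exp_neg_mul_sq hb f)
      (integrable_eval_mul_exp_neg_mul_sq hb g)]
    simp [add_mul]
  map_smul' a f := by
    rw [RingHom.id_apply, smul_eq_mul, ← integral_const_mul]
    simp [mul_assoc]

theorem gaussianMoment_apply {b : ℝ} (hb : 0 < b) (f : ℝ[X]) :
    gaussianMoment hb f = ∫ t : ℝ, f.eval t * Real.exp (-b * t ^ 2) := rfl

theorem gaussianMoment_pos {b : ℝ} (hb : 0 < b) {f : ℝ[X]} (hf : f ≠ 0)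
    (h : ∀ t, 0 ≤ f.eval t) : 0 < gaussianMoment hb f := by
  obtain ⟨t, ht⟩ : ∃ t, f.eval t ≠ 0 := by
    by_contra! h0
    exact hf (Polynomial.funext (by simpa using h0))
  refine integral_pos_of_integrable_nonneg_nonzero (x := t) (by fun_prop)
    (integrable_eval_mul_exp_neg_mul_sq hb f) (fun s => mul_nonneg (h s) (Real.exp_pos _).le)
    (mul_ne_zero ht (Real.exp_pos _).ne')

/-- Integration by parts: the derivative of `f e^{-b t²}` has integral zero. -/
theorem gaussianMoment_X_mul {b : ℝ} (hb : 0 < b) (f : ℝ[X]) :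
    2 * b * gaussianMoment hb (X * f) = gaussianMoment hb (derivative f) := by
  have hd : ∀ t : ℝ, HasDerivAt (fun t => f.eval t * Real.exp (-b * t ^ 2))
      ((derivative f - C (2 * b) * (X * f)).eval t * Real.exp (-b * t ^ 2)) t := by
    intro t
    have h1 : HasDerivAt (fun t : ℝ => -b * t ^ 2) (-b * (2 * t)) t := by
      simpa using (hasDerivAt_pow 2 t).const_mul (-b)
    refine ((f.hasDerivAt t).mul h1.exp).congr_deriv ?_
    simp
    ring
  have h := integral_eq_zero_of_hasDerivAt_of_integrable hd
    (integrable_eval_mul_exp_neg_mul_sq hb _) (integrable_eval_mul_exp_neg_mul_sq hb f)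
  rw [← gaussianMoment_apply hb, map_sub, ← smul_eq_C_mul, map_smul, smul_eq_mul] at h
  linarith

/-! ### Sign changes and interpolatory quadrature. -/

/-- A polynomial without zeros on an interval has constant sign there. -/
theorem eval_sign_of_forall_ne_zero {I : Set ℝ} (hI : I.OrdConnected) {Q : ℝ[X]}
    (h : ∀ x ∈ I, Q.eval x ≠ 0) : (∀ x ∈ I, 0 ≤ Q.eval x) ∨ ∀ x ∈ I, Q.eval x ≤ 0 := by
  by_contra! hc
  obtain ⟨⟨x, hx, hx0⟩, y, hy, hy0⟩ := hc
  obtain ⟨z, hz, hz0⟩ := hI.isPreconnected.intermediate_value hx hy Q.continuous.continuousOn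
    ⟨hx0.le, hy0.le⟩
  exact h z hz hz0

/-- The zeros of `Q` in an interval at which `Q` changes its sign. -/
theorem exists_finset_roots_mul_prod_sign {I : Set ℝ} (hI : I.OrdConnected) (Q : ℝ[X])
    (hQ : Q ≠ 0) :
    ∃ s : Finset ℝ, (∀ r ∈ s, r ∈ I ∧ Q.IsRoot r) ∧
      ((∀ x ∈ I, 0 ≤ (Q * ∏ r ∈ s, (X - C r)).eval x) ∨
        ∀ x ∈ I, (Q * ∏ r ∈ s, (X - C r)).eval x ≤ 0) := by
  induction hd : Q.natDegree using Nat.strong_induction_on generalizing Q with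
  | _ d ih =>
    by_cases h : ∀ x ∈ I, Q.eval x ≠ 0
    · exact ⟨∅, by simp, by simpa using eval_sign_of_forall_ne_zero hI h⟩
    push Not at h
    obtain ⟨r, hr, hr0⟩ := h
    obtain ⟨G, rfl⟩ := dvd_iff_isRoot.2 hr0
    have hG : G ≠ 0 := right_ne_zero_of_mul hQ
    obtain ⟨s, hs, hsign⟩ := ih G.natDegree
      (by rw [← hd, natDegree_mul (X_sub_C_ne_zero r) hG, natDegree_X_sub_C]; omega) G hG rfl
    -- Restoring the factor `X - r` changes the parity of the multiplicity of `r`, so membership of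
    -- `r` in `s` is toggled.
    by_cases hrs : r ∈ s
    · refine ⟨s.erase r, fun q hq => ?_, ?_⟩
      · obtain ⟨h1, h2⟩ := hs q (Finset.mem_of_mem_erase hq)
        exact ⟨h1, h2.dvd (Dvd.intro_left _ rfl)⟩
      · have : (X - C r) * G * ∏ r ∈ s.erase r, (X - C r) = G * ∏ r ∈ s, (X - C r) := by
          rw [← Finset.mul_prod_erase s _ hrs]; ring
        rwa [this]
    · refine ⟨insert r s, fun q hq => ?_, ?_⟩
      · rcases Finset.mem_insert.1 hq with rfl | hq
        · exact ⟨hr, hr0⟩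
        · obtain ⟨h1, h2⟩ := hs q hq
          exact ⟨h1, h2.dvd (Dvd.intro_left _ rfl)⟩
      · have (x : ℝ) : ((X - C r) * G * ∏ r ∈ insert r s, (X - C r)).eval x =
            (x - r) ^ 2 * (G * ∏ r ∈ s, (X - C r)).eval x := by
          rw [Finset.prod_insert hrs]; simp; ring
        simp only [this]
        exact hsign.imp (fun h x hx => mul_nonneg (sq_nonneg _) (h x hx))
          fun h x hx => mul_nonpos_of_nonneg_of_nonpos (sq_nonneg _) (h x hx)

/-- Exactness of the interpolatory quadrature rule at the zeros of a polynomial orthogonal to all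
polynomials of degree less than `m`. -/
theorem map_eq_sum_basis_of_orthogonal {ι : Type*} [DecidableEq ι] (L : ℝ[X] →ₗ[ℝ] ℝ)
    {s : Finset ι} {x : ι → ℝ} (hx : Set.InjOn x s) {m : ℕ} (hm : 0 < m)
    (horth : ∀ q : ℝ[X], q.natDegree < m → L (Lagrange.nodal s x * q) = 0)
    {f : ℝ[X]} (hf : f.natDegree < s.card + m) :
    L f = ∑ k ∈ s, L (Lagrange.basis s x k) * f.eval (x k) := by
  set P := Lagrange.nodal s x
  have hP : P.Monic := Lagrange.nodal_monic
  have hq : L (P * (f /ₘ P)) = 0 := horth _ (by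
    rw [natDegree_divByMonic f hP, Lagrange.natDegree_nodal]; omega)
  have hr : f %ₘ P = Lagrange.interpolate s x fun k => f.eval (x k) := by
    refine Lagrange.eq_interpolate_of_eval_eq _ hx ?_ fun i hi => ?_
    · simpa [P, Lagrange.degree_nodal] using degree_modByMonic_lt f hP
    · conv_rhs => rw [← modByMonic_add_div f P]
      simp [P, Lagrange.eval_nodal_at_node hi]
  conv_lhs => rw [← modByMonic_add_div f P]
  rw [map_add, hq, add_zero, hr, Lagrange.interpolate_apply, map_sum]
  refine Finset.sum_congr rfl fun k _ => ?_
  rw [← smul_eq_C_mul, map_smul, smul_eq_mul, mul_comm]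

/-! ### Hermite polynomials and their Gauss quadrature. -/

/-- The monic Hermite polynomials for the weight `e^{-b t²}`. -/
noncomputable def gaussianHermite (b : ℝ) : ℕ → ℝ[X]
  | 0 => 1
  | k + 1 => X * gaussianHermite b k - C (1 / (2 * b)) * derivative (gaussianHermite b k)

/-- Turns the defining recursion into the three-term recurrence. -/
theorem derivative_gaussianHermite (b : ℝ) (k : ℕ) :
    derivative (gaussianHermite b (k + 1)) = C ((k : ℝ) + 1) * gaussianHermite b k := by
  induction k with
  | zero => simp [gaussianHermite]
  | succ k ih =>
    rw [gaussianHermite, derivative_sub, derivative_mul, derivative_C_mul, ih, derivative_C_mul]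
    conv_rhs => rw [gaussianHermite]
    conv_lhs => simp only [gaussianHermite]
    simp only [derivative_X, map_add, map_one, Nat.cast_add, Nat.cast_one]
    ring

theorem gaussianHermite_monic_natDegree (b : ℝ) (k : ℕ) :
    (gaussianHermite b k).Monic ∧ (gaussianHermite b k).natDegree = k := by
  induction k with
  | zero => simp [gaussianHermite]
  | succ k ih =>
    obtain ⟨hm, hd⟩ := ih
    have hX : (X * gaussianHermite b k).Monic := monic_X.mul hm
    have hdeg : (X * gaussianHermite b k).natDegree = k + 1 := by
      rw [natDegree_X_mul hm.ne_zero, hd]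
    have hlt : (C (1 / (2 * b)) * derivative (gaussianHermite b k)).degree <
        (X * gaussianHermite b k).degree := by
      rw [degree_eq_natDegree hX.ne_zero, hdeg]
      refine lt_of_le_of_lt degree_le_natDegree (by
        have h1 := natDegree_C_mul_le (1 / (2 * b)) (derivative (gaussianHermite b k))
        have h2 := natDegree_derivative_le (gaussianHermite b k)
        exact_mod_cast (by omega))
    exact ⟨hX.sub_of_left hlt, by
      rw [gaussianHermite, natDegree_eq_of_degree_eq (degree_sub_eq_left_of_degree_lt hlt), hdeg]⟩

/-- Integration by parts trades `H_{k+1} f` for `H_k f' / (2b)`, and `f'` has smaller degree. -/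
theorem gaussianMoment_mul_gaussianHermite {b : ℝ} (hb : 0 < b) (k : ℕ) (f : ℝ[X])
    (hf : f.natDegree < k) : gaussianMoment hb (gaussianHermite b k * f) = 0 := by
  induction k generalizing f with
  | zero => simp at hf
  | succ k ih =>
    have h := gaussianMoment_X_mul hb (gaussianHermite b k * f)
    have h2 : gaussianMoment hb (gaussianHermite b k * derivative f) = 0 := by
      by_cases h0 : f.natDegree = 0
      · rw [natDegree_eq_zero] at h0
        obtain ⟨a, rfl⟩ := h0
        simp
      · exact ih _ (by have := natDegree_derivative_lt h0; omega)
    rw [derivative_mul, map_add, h2, add_zero] at h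
    have h3 : gaussianHermite b (k + 1) * f = X * (gaussianHermite b k * f) -
        (1 / (2 * b)) • (derivative (gaussianHermite b k) * f) := by
      rw [gaussianHermite, smul_eq_C_mul]; ring
    rw [h3, map_sub, map_smul, ← h, smul_eq_mul]
    field_simp
    ring

theorem gaussianHermite_eval_neg (b : ℝ) (k : ℕ) (x : ℝ) :
    (gaussianHermite b k).eval (-x) = (-1) ^ k * (gaussianHermite b k).eval x := by
  induction k using Nat.twoStepInduction generalizing x with
  | zero => simp [gaussianHermite]
  | one => simp [gaussianHermite]
  | more k ih1 ih2 =>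
    rw [gaussianHermite, derivative_gaussianHermite]
    simp only [eval_sub, eval_mul, eval_X, eval_C, ih1, ih2]
    ring

/-- Source of the radius 2: in `H_{k+2} = x H_{k+1} - ((k+1)/(2n)) H_k` the last coefficient is at
most 1 for `k + 1 ≤ 2n`, so for `x ≥ 2` the values keep increasing. -/
theorem gaussianHermite_eval_pos {n : ℕ} (hn : 0 < n) {x : ℝ} (hx : 2 ≤ x) (k : ℕ)
    (hk : k ≤ 2 * n) :
    0 < (gaussianHermite n k).eval x ∧
      (gaussianHermite n k).eval x ≤ (gaussianHermite n (k + 1)).eval x := by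
  have hn' : (0 : ℝ) < n := by exact_mod_cast hn
  induction k with
  | zero => simp [gaussianHermite]; linarith
  | succ k ih =>
    obtain ⟨h1, h2⟩ := ih (by omega)
    refine ⟨h1.trans_le h2, ?_⟩
    conv_rhs => rw [gaussianHermite, derivative_gaussianHermite]
    simp only [eval_sub, eval_mul, eval_X, eval_C]
    have h3 : 1 / (2 * (n : ℝ)) * (k + 1) ≤ 1 := by
      rw [one_div_mul_eq_div, div_le_one (by positivity)]
      exact_mod_cast hk
    have h4 : 0 ≤ 1 / (2 * (n : ℝ)) * (k + 1) := by positivity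
    nlinarith

theorem mem_Ioo_of_isRoot_gaussianHermite {n : ℕ} (hn : 0 < n) {r : ℝ}
    (hr : (gaussianHermite n (2 * n)).IsRoot r) : r ∈ Set.Ioo (-2 : ℝ) 2 := by
  constructor
  · by_contra! h
    have h1 := (gaussianHermite_eval_pos hn (x := -r) (by linarith) (2 * n) le_rfl).1
    rw [gaussianHermite_eval_neg, hr.eq_zero] at h1
    simp at h1
  · by_contra! h
    exact (gaussianHermite_eval_pos hn h (2 * n) le_rfl).1.ne' hr

/-- The Hermite polynomial has as many distinct real zeros as its degree. -/
theorem exists_gaussianHermite_eq_nodal {b : ℝ} (hb : 0 < b) (k : ℕ) :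
    ∃ s : Finset ℝ, s.card = k ∧ gaussianHermite b k = Lagrange.nodal s id := by
  obtain ⟨hm, hd⟩ := gaussianHermite_monic_natDegree b k
  obtain ⟨s, hs, hsign⟩ := exists_finset_roots_mul_prod_sign Set.ordConnected_univ _ hm.ne_zero
  have hprod : ∏ r ∈ s, (X - C r) = Lagrange.nodal s id := by simp [Lagrange.nodal_eq]
  rw [hprod] at hsign
  have hdvd : Lagrange.nodal s id ∣ gaussianHermite b k := by
    rw [Lagrange.nodal_eq]
    refine Finset.prod_dvd_of_coprime (fun i _ j _ hij => ?_)
      fun r hr => dvd_iff_isRoot.2 (hs r hr).2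
    exact isCoprime_X_sub_C_of_isUnit_sub (sub_ne_zero.2 hij).isUnit
  have hle : s.card ≤ k := by
    simpa [hd, Lagrange.natDegree_nodal] using natDegree_le_of_dvd hdvd hm.ne_zero
  have hge : k ≤ s.card := by
    by_contra! hlt
    have h0 := gaussianMoment_mul_gaussianHermite hb k (Lagrange.nodal s id)
      (by rwa [Lagrange.natDegree_nodal])
    have hne := mul_ne_zero hm.ne_zero (Lagrange.nodal_ne_zero (s := s) (v := (id : ℝ → ℝ)))
    rcases hsign with h | h
    · exact (gaussianMoment_pos hb hne fun t => h t trivial).ne' h0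
    · have := gaussianMoment_pos hb (neg_ne_zero.2 hne) fun t => by
        simpa using h t trivial
      rw [map_neg, h0] at this
      simp at this
  have hcard := le_antisymm hle hge
  exact ⟨s, hcard, eq_of_monic_of_dvd_of_natDegree_le Lagrange.nodal_monic hm hdvd
    (by rw [hd, Lagrange.natDegree_nodal, hcard])⟩

/-- The rule is exact for the square of a Lagrange basis polynomial, whose positive integral is
therefore the weight. -/
theorem gaussianMoment_basis_pos {b : ℝ} (hb : 0 < b) {s : Finset ℝ}
    (hs : gaussianHermite b s.card = Lagrange.nodal s id) {r : ℝ} (hr : r ∈ s) :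
    0 < gaussianMoment hb (Lagrange.basis s id r) := by
  have hc : 0 < s.card := Finset.card_pos.2 ⟨r, hr⟩
  have hne := Lagrange.basis_ne_zero (Set.injOn_id (s : Set ℝ)) hr
  have h := map_eq_sum_basis_of_orthogonal (gaussianMoment hb) (Set.injOn_id (s : Set ℝ)) hc
    (fun q hq => by rw [← hs]; exact gaussianMoment_mul_gaussianHermite hb _ q hq)
    (f := Lagrange.basis s id r ^ 2)
    (by rw [natDegree_pow, Lagrange.natDegree_basis (Set.injOn_id _) hr]; omega)
  rw [Finset.sum_eq_single r] at h
  · rw [eval_pow, Lagrange.eval_basis_self (Set.injOn_id _) hr, one_pow, mul_one] at h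
    rw [← h]
    exact gaussianMoment_pos hb (pow_ne_zero 2 hne) fun t => by rw [eval_pow]; positivity
  · intro q hq hqr
    rw [eval_pow, Lagrange.eval_basis_of_ne hqr.symm hq]
    simp
  · exact fun h => absurd hr h

/-- A zero of a polynomial at which it has a local minimum is a multiple zero. -/
theorem X_sub_C_sq_dvd_of_isLocalMin {f : ℝ[X]} {r : ℝ} (hr : f.IsRoot r)
    (hmin : IsLocalMin (fun t => f.eval t) r) : (X - C r) ^ 2 ∣ f := by
  have hd : (derivative f).eval r = 0 := hmin.hasDerivAt_eq_zero (f.hasDerivAt r)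
  obtain ⟨g, rfl⟩ := dvd_iff_isRoot.2 hr
  have hg : g.IsRoot r := by simpa [derivative_mul] using hd
  rw [pow_two]
  exact mul_dvd_mul_left _ (dvd_iff_isRoot.2 hg)

/-- Nonnegativity on `[-2, 2]` of a polynomial of degree less than `4n` suffices for the positivity
of its integral against `e^{-n t²}` over the whole line. -/
theorem gaussianMoment_pos_of_nonneg_Icc {n : ℕ} (hn : (0 : ℝ) < n) {f : ℝ[X]} (hf : f ≠ 0)
    (hdeg : f.natDegree < 4 * n) (hpos : ∀ t ∈ Set.Icc (-2 : ℝ) 2, 0 ≤ f.eval t) :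
    0 < gaussianMoment hn f := by
  have hn0 : 0 < n := by exact_mod_cast hn
  obtain ⟨s, hcard, hs⟩ := exists_gaussianHermite_eq_nodal hn (2 * n)
  have hmem : ∀ r ∈ s, r ∈ Set.Ioo (-2 : ℝ) 2 := fun r hr =>
    mem_Ioo_of_isRoot_gaussianHermite hn0 (by
      rw [hs]; exact Lagrange.eval_nodal_at_node (v := (id : ℝ → ℝ)) hr)
  have hL := map_eq_sum_basis_of_orthogonal (gaussianMoment hn) (Set.injOn_id (s : Set ℝ))
    (m := 2 * n) (by omega)
    (fun q hq => by rw [← hs]; exact gaussianMoment_mul_gaussianHermite hn _ q hq)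
    (f := f) (by omega)
  have hw : ∀ r ∈ s, 0 < gaussianMoment hn (Lagrange.basis s id r) := fun r hr =>
    gaussianMoment_basis_pos hn (by rw [hcard, hs]) hr
  have hval : ∀ r ∈ s, 0 ≤ f.eval r := fun r hr => hpos r (Set.Ioo_subset_Icc_self (hmem r hr))
  rw [hL]
  refine Finset.sum_pos' (fun r hr => mul_nonneg (hw r hr).le (hval r hr)) ?_
  -- If every term vanished, each of the `2n` interior nodes would be a double zero of `f`, forcing
  -- degree at least `4n`.
  by_contra! hc
  have hroot : ∀ r ∈ s, f.IsRoot r := fun r hr =>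
    le_antisymm (le_of_not_gt fun h => (mul_pos (hw r hr) h).not_ge (hc r hr)) (hval r hr)
  have hdvd : ∏ r ∈ s, (X - C r) ^ 2 ∣ f := by
    refine Finset.prod_dvd_of_coprime (fun i _ j _ hij => ?_) fun r hr => ?_
    · exact (isCoprime_X_sub_C_of_isUnit_sub (sub_ne_zero.2 hij).isUnit).pow
    · refine X_sub_C_sq_dvd_of_isLocalMin (hroot r hr) ?_
      filter_upwards [isOpen_Ioo.mem_nhds (hmem r hr)] with t ht
      rw [(hroot r hr).eq_zero]
      exact hpos t (Set.Ioo_subset_Icc_self ht)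
  have h := natDegree_le_of_dvd hdvd hf
  rw [natDegree_prod _ _ fun r _ => pow_ne_zero 2 (X_sub_C_ne_zero r)] at h
  simp [hcard] at h
  omega

/-! ### Shifted weights and location of the zeros. -/

/-- The points at which the three scaled Hermite weights are maximal. -/
noncomputable def scaledHermiteCenter (c : ℝ) : Fin 3 → ℝ := ![-(c / 2), 0, c / 2]

theorem scaledHermiteWeight_eq (n : ℕ) (c : ℝ) (j : Fin 3) (t : ℝ) :
    scaledHermiteWeight n c j t = Real.exp (n * scaledHermiteCenter c j ^ 2) *
      Real.exp (-n * (t - scaledHermiteCenter c j) ^ 2) := by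
  rw [← Real.exp_add]
  fin_cases j <;> simp [scaledHermiteWeight, scaledHermiteCenter] <;> ring

/-- Integration of polynomials against a scaled Hermite weight. -/
noncomputable def scaledHermiteMoment {n : ℕ} (hn : (0 : ℝ) < n) (c : ℝ) (j : Fin 3) :
    ℝ[X] →ₗ[ℝ] ℝ :=
  Real.exp (n * scaledHermiteCenter c j ^ 2) •
    (gaussianMoment hn ∘ₗ taylor (scaledHermiteCenter c j))

theorem integral_eval_mul_scaledHermiteWeight {n : ℕ} (hn : (0 : ℝ) < n) (c : ℝ) (j : Fin 3)
    (f : ℝ[X]) : ∫ t : ℝ, f.eval t * scaledHermiteWeight n c j t =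
      scaledHermiteMoment hn c j f := by
  set a := scaledHermiteCenter c j with ha
  rw [← integral_add_right_eq_self _ a]
  simp only [scaledHermiteMoment, LinearMap.smul_apply, LinearMap.comp_apply, smul_eq_mul,
    gaussianMoment_apply, ← integral_const_mul, scaledHermiteWeight_eq, ← ha, taylor_eval]
  refine integral_congr_ae (Filter.Eventually.of_forall fun t => ?_)
  simp only [add_sub_cancel_right]
  ring_nf

theorem scaledHermiteMoment_pos {n : ℕ} (hn : (0 : ℝ) < n) (c : ℝ) (j : Fin 3) {f : ℝ[X]}
    (hf : f ≠ 0) (hdeg : f.natDegree < 4 * n)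
    (hpos : ∀ t ∈ Set.Icc (scaledHermiteCenter c j - 2) (scaledHermiteCenter c j + 2),
      0 ≤ f.eval t) : 0 < scaledHermiteMoment hn c j f := by
  refine mul_pos (Real.exp_pos _) (gaussianMoment_pos_of_nonneg_Icc hn ?_ ?_ fun t ht => ?_)
  · simpa using (taylor_injective (scaledHermiteCenter c j)).ne hf
  · rwa [natDegree_taylor]
  · rw [taylor_eval]
    exact hpos _ ⟨by linarith [ht.1], by linarith [ht.2]⟩

theorem map_mul_eq_zero_of_forall_X_pow (L : ℝ[X] →ₗ[ℝ] ℝ) {Q : ℝ[X]} {n : ℕ}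
    (h : ∀ i < n, L (X ^ i * Q) = 0) {q : ℝ[X]} (hq : q.natDegree < n) : L (Q * q) = 0 := by
  rw [as_sum_range_C_mul_X_pow' q hq, Finset.mul_sum, map_sum]
  refine Finset.sum_eq_zero fun i hi => ?_
  rw [mul_left_comm, ← smul_eq_C_mul, map_smul, mul_comm, h i (Finset.mem_range.1 hi), smul_zero]

theorem exists_roots_near_center {n : ℕ} (hn : (0 : ℝ) < n) (c : ℝ) (j : Fin 3) {Q : ℝ[X]}
    (hQ : Q ≠ 0) (hdeg : Q.natDegree ≤ 3 * n)
    (horth : ∀ i < n, scaledHermiteMoment hn c j (X ^ i * Q) = 0) :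
    ∃ s : Finset ℝ, s.card = n ∧ ∀ r ∈ s,
      r ∈ Set.Icc (scaledHermiteCenter c j - 2) (scaledHermiteCenter c j + 2) ∧ Q.IsRoot r := by
  obtain ⟨s, hs, hsign⟩ := exists_finset_roots_mul_prod_sign
    (Set.ordConnected_Icc (a := scaledHermiteCenter c j - 2) (b := scaledHermiteCenter c j + 2))
    Q hQ
  have hprod : ∏ r ∈ s, (X - C r) = Lagrange.nodal s id := by simp [Lagrange.nodal_eq]
  rw [hprod] at hsign
  have hge : n ≤ s.card := by
    by_contra! hlt
    have hnod := Lagrange.nodal_ne_zero (s := s) (v := (id : ℝ → ℝ))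
    have h0 := map_mul_eq_zero_of_forall_X_pow _ horth
      (q := Lagrange.nodal s id) (by rwa [Lagrange.natDegree_nodal])
    have hne := mul_ne_zero hQ hnod
    have hd : (Q * Lagrange.nodal s id).natDegree < 4 * n := by
      rw [natDegree_mul hQ hnod, Lagrange.natDegree_nodal]; omega
    rcases hsign with h | h
    · exact (scaledHermiteMoment_pos hn c j hne hd h).ne' h0
    · have := scaledHermiteMoment_pos hn c j (neg_ne_zero.2 hne) (by rwa [natDegree_neg])
        fun t ht => by simpa using h t ht
      rw [map_neg, h0] at this
      simp at this
  obtain ⟨t, hts, ht⟩ := Finset.exists_subset_card_eq hge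
  exact ⟨t, ht, fun r hr => hs r (hts hr)⟩

/-- For well separated weights the zeros of a nonzero polynomial of degree at most `3n` with the
orthogonality relations fall into three groups of `n` zeros. -/
theorem exists_nodal_dvd_of_orthogonal {n : ℕ} (hn : (0 : ℝ) < n) {c : ℝ} (hc : 8 < c)
    {Q : ℝ[X]} (hQ : Q ≠ 0) (hdeg : Q.natDegree ≤ 3 * n)
    (horth : ∀ j, ∀ i < n, scaledHermiteMoment hn c j (X ^ i * Q) = 0) :
    ∃ T : Finset ℝ, T.card = 3 * n ∧ Lagrange.nodal T id ∣ Q ∧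
      (T.filter (· < -2)).card = n ∧ (T.filter (· ≤ 2)).card = 2 * n := by
  choose s hcard hs using fun j => exists_roots_near_center hn c j hQ hdeg (horth j)
  have h0 : ∀ r ∈ s 0, r < -2 := fun r hr => by
    have := (hs 0 r hr).1.2
    simp [scaledHermiteCenter] at this
    linarith
  have h1 : ∀ r ∈ s 1, -2 ≤ r ∧ r ≤ 2 := fun r hr => by
    simpa [scaledHermiteCenter] using (hs 1 r hr).1
  have h2 : ∀ r ∈ s 2, 2 < r := fun r hr => by
    have := (hs 2 r hr).1.1
    simp [scaledHermiteCenter] at this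
    linarith
  have d01 : Disjoint (s 0) (s 1) := Finset.disjoint_left.2 fun r hr hr' => by
    linarith [h0 r hr, (h1 r hr').1]
  have d2 : Disjoint (s 0 ∪ s 1) (s 2) := Finset.disjoint_left.2 fun r hr hr' => by
    rcases Finset.mem_union.1 hr with hr | hr
    · linarith [h0 r hr, h2 r hr']
    · linarith [h1 r hr, h2 r hr']
  refine ⟨s 0 ∪ s 1 ∪ s 2, ?_, ?_, ?_, ?_⟩
  · rw [Finset.card_union_of_disjoint d2, Finset.card_union_of_disjoint d01]
    simp only [hcard]
    omega
  · rw [Lagrange.nodal_eq]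
    refine Finset.prod_dvd_of_coprime (fun i _ j _ hij => ?_) fun r hr => ?_
    · exact isCoprime_X_sub_C_of_isUnit_sub (sub_ne_zero.2 hij).isUnit
    · simp only [Finset.mem_union] at hr
      rcases hr with (hr | hr) | hr <;> exact dvd_iff_isRoot.2 (hs _ r hr).2
  · rw [← hcard 0]
    congr 1
    ext r
    simp only [Finset.mem_filter, Finset.mem_union]
    refine ⟨fun ⟨h, hr⟩ => ?_, fun h => ⟨.inl (.inl h), h0 r h⟩⟩
    rcases h with (h | h) | h
    · exact h
    · linarith [(h1 r h).1]
    · linarith [h2 r h]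
  · have : (s 0 ∪ s 1).card = 2 * n := by
      rw [Finset.card_union_of_disjoint d01, hcard, hcard]; omega
    rw [← this]
    congr 1
    ext r
    simp only [Finset.mem_filter, Finset.mem_union]
    refine ⟨fun ⟨h, hr⟩ => ?_, fun h => ⟨.inl h, ?_⟩⟩
    · rcases h with h | h
      · exact h
      · linarith [h2 r h]
    · rcases h with h | h
      · linarith [h0 r h]
      · exact (h1 r h).2

/-! ### Existence and uniqueness. -/

theorem isTypeIIMultipleOrthogonal_scaledHermiteWeight_iff {n : ℕ} (hn : (0 : ℝ) < n) (c : ℝ)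
    (P : ℝ[X]) : IsTypeIIMultipleOrthogonal (scaledHermiteWeight n c) (fun _ => n) P ↔
      P.Monic ∧ P.natDegree = 3 * n ∧
        ∀ j, ∀ i < n, scaledHermiteMoment hn c j (X ^ i * P) = 0 := by
  simp [IsTypeIIMultipleOrthogonal, ← integral_eval_mul_scaledHermiteWeight]

theorem eq_zero_of_orthogonal {n : ℕ} (hn : (0 : ℝ) < n) {c : ℝ} (hc : 8 < c) {Q : ℝ[X]}
    (hdeg : Q.degree < (3 * n : ℕ))
    (horth : ∀ j, ∀ i < n, scaledHermiteMoment hn c j (X ^ i * Q) = 0) : Q = 0 := by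
  by_contra hQ
  have hd : Q.natDegree < 3 * n := (natDegree_lt_iff_degree_lt hQ).2 hdeg
  obtain ⟨T, hT, hdvd, -⟩ := exists_nodal_dvd_of_orthogonal hn hc hQ hd.le horth
  have := natDegree_le_of_dvd hdvd hQ
  rw [Lagrange.natDegree_nodal] at this
  omega

/-- The lower coefficients solve a square linear system of size `3n`, injective because a nonzero
kernel element would have `3n` zeros but degree below `3n`. -/
theorem existsUnique_isTypeIIMultipleOrthogonal {n : ℕ} (hn : (0 : ℝ) < n) {c : ℝ} (hc : 8 < c) :
    ∃! P : ℝ[X], IsTypeIIMultipleOrthogonal (scaledHermiteWeight n c) (fun _ => n) P := by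
  simp only [isTypeIIMultipleOrthogonal_scaledHermiteWeight_iff hn]
  let φ : ℝ[X] →ₗ[ℝ] (Fin 3 × Fin n → ℝ) := LinearMap.pi fun p =>
    scaledHermiteMoment hn c p.1 ∘ₗ LinearMap.mulLeft ℝ (X ^ (p.2 : ℕ))
  let ψ : degreeLT ℝ (3 * n) →ₗ[ℝ] (Fin 3 × Fin n → ℝ) := φ ∘ₗ (degreeLT ℝ (3 * n)).subtype
  have hinj : Function.Injective ψ := by
    rw [← LinearMap.ker_eq_bot, LinearMap.ker_eq_bot']
    rintro ⟨Q, hQ⟩ h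
    refine Subtype.ext (eq_zero_of_orthogonal hn hc (mem_degreeLT.1 hQ) fun j i hi => ?_)
    simpa [ψ, φ] using congrFun h (j, ⟨i, hi⟩)
  have : FiniteDimensional ℝ (degreeLT ℝ (3 * n)) :=
    (degreeLTEquiv ℝ (3 * n)).symm.finiteDimensional
  have hrank : Module.finrank ℝ (degreeLT ℝ (3 * n)) =
      Module.finrank ℝ (Fin 3 × Fin n → ℝ) := by
    rw [(degreeLTEquiv ℝ (3 * n)).finrank_eq]
    simp
  obtain ⟨⟨Q, hQ⟩, hφ⟩ :=
    (LinearMap.injective_iff_surjective_of_finrank_eq_finrank hrank).1 hinj (-φ (X ^ (3 * n)))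
  have hQd := mem_degreeLT.1 hQ
  have hmonic : (X ^ (3 * n) + Q).Monic := monic_X_pow_add hQd
  have hnat : (X ^ (3 * n) + Q).natDegree = 3 * n :=
    natDegree_eq_of_degree_eq_some <| by
      rw [degree_add_eq_left_of_degree_lt (by rwa [degree_X_pow]), degree_X_pow]
  refine ⟨X ^ (3 * n) + Q, ⟨hmonic, hnat, fun j i hi => ?_⟩, fun P ⟨hm, hd, ho⟩ => ?_⟩
  · have := congrFun hφ (j, ⟨i, hi⟩)
    simp only [ψ, φ, LinearMap.comp_apply, LinearMap.pi_apply, Submodule.subtype_apply,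
      LinearMap.mulLeft_apply, Pi.neg_apply] at this
    rw [mul_add, map_add, this, add_neg_cancel]
  · rw [← sub_eq_zero]
    refine eq_zero_of_orthogonal hn hc ?_ fun j i hi => ?_
    · have h1 : P.degree = (X ^ (3 * n) + Q).degree := by
        rw [degree_eq_natDegree hm.ne_zero, degree_eq_natDegree hmonic.ne_zero, hd, hnat]
      refine (degree_sub_lt_left h1 hm.ne_zero (by rw [hm.leadingCoeff, hmonic.leadingCoeff])).trans_le
        ?_
      rw [degree_eq_natDegree hm.ne_zero, hd]
    · have := congrFun hφ (j, ⟨i, hi⟩)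
      simp only [ψ, φ, LinearMap.comp_apply, LinearMap.pi_apply, Submodule.subtype_apply,
        LinearMap.mulLeft_apply, Pi.neg_apply] at this
      rw [mul_sub, mul_add, map_sub, map_add, this, ho j i hi, add_neg_cancel, sub_zero]

/-! ### Ordering of the nodes and signs of products. -/

/-- The position of the nodes below a threshold is determined by their number. -/
theorem threshold_iff_le_card {N m : ℕ} {x : ℕ → ℝ} (hx : StrictMonoOn x (Set.Icc 1 N))
    (p : ℝ → Prop) [DecidablePred p] (hp : ∀ a b, a ≤ b → p b → p a)
    (hm : (((Finset.Icc 1 N).image x).filter p).card = m) {k : ℕ} (hk : k ∈ Finset.Icc 1 N) :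
    p (x k) ↔ k ≤ m := by
  rw [Finset.filter_image, Finset.card_image_of_injOn
    (hx.injOn.mono fun i hi => by simpa using (Finset.mem_filter.1 hi).1)] at hm
  rw [Finset.mem_Icc] at hk
  constructor
  · intro h
    rw [← hm, ← Nat.card_Icc 1 k |>.trans (Nat.add_sub_cancel k 1)]
    refine Finset.card_le_card fun i hi => ?_
    rw [Finset.mem_Icc] at hi
    refine Finset.mem_filter.2 ⟨Finset.mem_Icc.2 ⟨hi.1, hi.2.trans hk.2⟩, hp _ _ ?_ h⟩
    exact hx.monotoneOn ⟨hi.1, hi.2.trans hk.2⟩ hk hi.2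
  · contrapose!
    intro h
    have : m ≤ (Finset.Icc 1 (k - 1)).card := by
      rw [← hm]
      refine Finset.card_le_card fun i hi => ?_
      obtain ⟨hi, hpi⟩ := Finset.mem_filter.1 hi
      rw [Finset.mem_Icc] at hi ⊢
      refine ⟨hi.1, ?_⟩
      by_contra! hlt
      exact h (hp _ _ (hx.monotoneOn hk hi (by omega)) hpi)
    rw [Nat.card_Icc] at this
    omega

theorem exists_isIncreasingZeros_nodal {N : ℕ} {T : Finset ℝ} (hT : T.card = N) :
    ∃ x : ℕ → ℝ, IsIncreasingZeros (Lagrange.nodal T id) N x := by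
  have hroot (t : ℝ) : (Lagrange.nodal T id).IsRoot t ↔ t ∈ T := by
    simp [IsRoot, Lagrange.eval_nodal, Finset.prod_eq_zero_iff, sub_eq_zero]
  -- Nodes are numbered from 1 but `orderEmbOfFin` from 0; values outside `Icc 1 N` play no role.
  refine ⟨fun k => if h : k - 1 < N then T.orderEmbOfFin hT ⟨k - 1, h⟩ else 0, ?_, fun t => ?_⟩
  · intro i hi j hj hij
    simp only [Set.mem_Icc] at hi hj
    beta_reduce
    rw [dif_pos (by omega), dif_pos (by omega)]
    exact (T.orderEmbOfFin hT).strictMono (by simp only [Fin.mk_lt_mk]; omega)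
  · rw [hroot, ← Finset.mem_coe, ← Finset.range_orderEmbOfFin T hT]
    constructor
    · rintro ⟨i, rfl⟩
      exact ⟨i + 1, ⟨by omega, by omega⟩, by simp⟩
    · rintro ⟨k, ⟨h1, h2⟩, rfl⟩
      exact ⟨⟨k - 1, by omega⟩, by beta_reduce; rw [dif_pos]⟩

theorem prod_sub_sign {S : Finset ℕ} {x : ℕ → ℝ} {k : ℕ} (hx : StrictMonoOn x (insert k S))
    (hk : k ∉ S) :
    0 < (∏ i ∈ S, (x k - x i)) * (-1) ^ (S.filter (k < ·)).card ∧
      0 < (∏ i ∈ S, (x i - x k)) * (-1) ^ (S.filter (· < k)).card := by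
  have hmem : ∀ i ∈ S, i ∈ (insert k S : Set ℕ) := fun i hi => Set.mem_insert_of_mem _ hi
  have hkm : k ∈ (insert k S : Set ℕ) := Set.mem_insert _ _
  have hne : ∀ i ∈ S, i ≠ k := fun i hi h => hk (h ▸ hi)
  constructor
  · rw [← Finset.prod_const, Finset.prod_filter, ← Finset.prod_mul_distrib]
    refine Finset.prod_pos fun i hi => ?_
    split_ifs with h
    · linarith [hx hkm (hmem i hi) h]
    · linarith [hx (hmem i hi) hkm (by have := hne i hi; omega)]
  · rw [← Finset.prod_const, Finset.prod_filter, ← Finset.prod_mul_distrib]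
    refine Finset.prod_pos fun i hi => ?_
    split_ifs with h
    · linarith [hx (hmem i hi) hkm h]
    · linarith [hx hkm (hmem i hi) (by have := hne i hi; omega)]

theorem sign_eq_neg_one_pow {a : ℝ} {m : ℕ} (h : 0 < a * (-1) ^ m) :
    Real.sign a = (-1) ^ m := by
  rcases neg_one_pow_eq_or ℝ m with hm | hm <;> rw [hm] at h ⊢
  · exact Real.sign_of_pos (by linarith)
  · exact Real.sign_of_neg (by linarith)

/-! ### Quadrature for the middle weight. -/

theorem quadratureWeight_eq {n : ℕ} (hn : (0 : ℝ) < n) (c : ℝ) (x : ℕ → ℝ) (k : ℕ) :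
    quadratureWeight (scaledHermiteWeight n c 1) (3 * n) x k =
    scaledHermiteMoment hn c 1 (Lagrange.basis (Finset.Icc 1 (3 * n)) x k) :=
  integral_eval_mul_scaledHermiteWeight hn c 1 _

theorem integral_eq_sum_quadratureWeight {n : ℕ} (hn : (0 : ℝ) < n) (c : ℝ)
    {x : ℕ → ℝ} (hx : StrictMonoOn x (Set.Icc 1 (3 * n)))
    (horth : ∀ i < n,
      scaledHermiteMoment hn c 1 (X ^ i * Lagrange.nodal (Finset.Icc 1 (3 * n)) x) = 0)
    {f : ℝ[X]} (hf : f.natDegree < 4 * n) :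
    scaledHermiteMoment hn c 1 f = ∑ k ∈ Finset.Icc 1 (3 * n),
      quadratureWeight (scaledHermiteWeight n c 1) (3 * n) x k * f.eval (x k) := by
  simp only [quadratureWeight_eq hn]
  refine map_eq_sum_basis_of_orthogonal _ (by simpa using hx.injOn) (m := n)
    (by exact_mod_cast hn) (fun q hq => map_mul_eq_zero_of_forall_X_pow _ horth hq) ?_
  rw [Nat.card_Icc]
  omega

/-- The sign of a quadrature weight is the sign at its node of a polynomial that vanishes at all
other nodes, is nonnegative on `[-2, 2]`, and has degree less than `4n`. -/
theorem quadratureWeight_mul_prod_pos {n : ℕ} (hn : (0 : ℝ) < n) (c : ℝ)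
    {x : ℕ → ℝ} (hx : StrictMonoOn x (Set.Icc 1 (3 * n)))
    (horth : ∀ i < n,
      scaledHermiteMoment hn c 1 (X ^ i * Lagrange.nodal (Finset.Icc 1 (3 * n)) x) = 0)
    (hleft : ∀ i, 1 ≤ i → i ≤ n → x i < -2)
    (hright : ∀ i, 2 * n + 1 ≤ i → i ≤ 3 * n → 2 < x i)
    {A B M : Finset ℕ} (hA : A ⊆ Finset.Icc 1 n) (hB : B ⊆ Finset.Icc (2 * n + 1) (3 * n))
    (hcard : A.card + B.card + 2 * M.card < 4 * n) {k : ℕ} (hk : k ∈ Finset.Icc 1 (3 * n))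
    (hcover : ∀ i ∈ Finset.Icc 1 (3 * n), i ≠ k → i ∈ A ∨ i ∈ B ∨ i ∈ M) :
    0 < quadratureWeight (scaledHermiteWeight n c 1) (3 * n) x k *
      ((∏ i ∈ A, (x k - x i)) * (∏ i ∈ B, (x i - x k)) * (∏ i ∈ M, (x k - x i)) ^ 2) := by
  set f : ℝ[X] := (∏ i ∈ A, (X - C (x i))) * (∏ i ∈ B, (C (x i) - X)) *
    (∏ i ∈ M, (X - C (x i))) ^ 2 with hf
  have heval (t : ℝ) : f.eval t =
      (∏ i ∈ A, (t - x i)) * (∏ i ∈ B, (x i - t)) * (∏ i ∈ M, (t - x i)) ^ 2 := by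
    simp [hf, eval_prod]
  have hXC (a : ℝ) : (C a - X : ℝ[X]) = -(X - C a) := by ring
  have hne : f ≠ 0 := by
    refine mul_ne_zero (mul_ne_zero ?_ ?_) (pow_ne_zero _ ?_) <;>
      refine Finset.prod_ne_zero_iff.2 fun i _ => ?_
    · exact X_sub_C_ne_zero _
    · rw [hXC]; exact neg_ne_zero.2 (X_sub_C_ne_zero _)
    · exact X_sub_C_ne_zero _
  have hdeg : f.natDegree < 4 * n := by
    refine lt_of_le_of_lt ?_ hcard
    refine natDegree_mul_le_of_le (natDegree_mul_le_of_le ?_ ?_) (natDegree_pow_le_of_le 2 ?_) <;>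
      refine (natDegree_prod_le _ _).trans ?_
    · simp
    · simp only [hXC, natDegree_neg, natDegree_X_sub_C]; simp
    · simp
  have hpos := scaledHermiteMoment_pos hn c 1 hne hdeg (fun t ht => by
    simp only [scaledHermiteCenter, Matrix.cons_val_one, Matrix.cons_val_zero, zero_sub,
      zero_add] at ht
    rw [heval]
    refine mul_nonneg (mul_nonneg (Finset.prod_nonneg fun i hi => ?_)
      (Finset.prod_nonneg fun i hi => ?_)) (sq_nonneg _)
    · have h := Finset.mem_Icc.1 (hA hi)
      linarith [hleft i h.1 h.2, ht.1]
    · have h := Finset.mem_Icc.1 (hB hi)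
      linarith [hright i h.1 h.2, ht.2])
  rw [integral_eq_sum_quadratureWeight hn c hx horth hdeg, Finset.sum_eq_single k] at hpos
  · rwa [heval] at hpos
  · intro i hi hik
    rw [heval]
    rcases hcover i hi hik with h | h | h
    · rw [Finset.prod_eq_zero h (sub_self _)]; simp
    · rw [Finset.prod_eq_zero (s := B) h (sub_self _)]; simp
    · rw [Finset.prod_eq_zero (s := M) h (sub_self _)]; simp
  · exact fun h => absurd hk h

theorem theorem5p5 :
    ∃ C : ℝ, ∀ c : ℝ, C < c → ∀ n : ℕ, 1 ≤ n →
      -- the multiple Hermite polynomial exists and is unique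
      (∃! P : ℝ[X], IsTypeIIMultipleOrthogonal (scaledHermiteWeight n c) (fun _ => n) P) ∧
      ∀ P : ℝ[X], IsTypeIIMultipleOrthogonal (scaledHermiteWeight n c) (fun _ => n) P →
        -- it has `3n` distinct real zeros
        (∃ x : ℕ → ℝ, IsIncreasingZeros P (3 * n) x) ∧
        ∀ x : ℕ → ℝ, IsIncreasingZeros P (3 * n) x →
          -- the quadrature rule for the middle weight is exact up to degree `4n - 1`
          (∀ f : ℝ[X], f.natDegree ≤ 4 * n - 1 →
            ∫ t : ℝ, f.eval t * scaledHermiteWeight n c 1 t =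
              ∑ k ∈ Finset.Icc 1 (3 * n),
                quadratureWeight (scaledHermiteWeight n c 1) (3 * n) x k * f.eval (x k)) ∧
          -- the signs of its weights
          (∀ k : ℕ, n + 1 ≤ k → k ≤ 2 * n →
            0 < quadratureWeight (scaledHermiteWeight n c 1) (3 * n) x k) ∧
          (∀ k : ℕ, 1 ≤ k → k ≤ n →
            Real.sign (quadratureWeight (scaledHermiteWeight n c 1) (3 * n) x k) =
              (-1 : ℝ) ^ ((k : ℤ) - (n : ℤ))) ∧
          (∀ k : ℕ, 2 * n + 1 ≤ k → k ≤ 3 * n →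
            Real.sign (quadratureWeight (scaledHermiteWeight n c 1) (3 * n) x k) =
              (-1 : ℝ) ^ (k + 1)) := by
  -- Windows of radius 2 whose centers are `c/2` apart are disjoint once `c > 8`.
  refine ⟨8, fun c hc n hn1 => ?_⟩
  have hn : (0 : ℝ) < n := by exact_mod_cast hn1
  refine ⟨existsUnique_isTypeIIMultipleOrthogonal hn hc, fun P hP => ?_⟩
  rw [isTypeIIMultipleOrthogonal_scaledHermiteWeight_iff hn] at hP
  obtain ⟨hm, hd, horth⟩ := hP
  obtain ⟨T, hT, hdvd, hT1, hT2⟩ := exists_nodal_dvd_of_orthogonal hn hc hm.ne_zero hd.le horth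
  have hPT : P = Lagrange.nodal T id :=
    eq_of_monic_of_dvd_of_natDegree_le Lagrange.nodal_monic hm hdvd
      (by rw [hd, Lagrange.natDegree_nodal, hT])
  refine ⟨hPT ▸ exists_isIncreasingZeros_nodal hT, fun x ⟨hx, hroots⟩ => ?_⟩
  have himage : (Finset.Icc 1 (3 * n)).image x = T := by
    ext t
    have := hroots t
    rw [hPT, IsRoot, Lagrange.eval_nodal, Finset.prod_eq_zero_iff] at this
    simpa [sub_eq_zero, eq_comm] using this.symm
  have hPx : P = Lagrange.nodal (Finset.Icc 1 (3 * n)) x := by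
    rw [hPT, Lagrange.nodal_eq, Lagrange.nodal_eq, ← himage,
      Finset.prod_image (by simpa using hx.injOn)]
    rfl
  have horth1 := horth 1
  rw [hPx] at horth1
  have hlt2 (k : ℕ) (hk : k ∈ Finset.Icc 1 (3 * n)) : x k < -2 ↔ k ≤ n :=
    threshold_iff_le_card hx (· < -2) (fun a b h h' => h.trans_lt h') (by rw [himage, hT1]) hk
  have hle2 (k : ℕ) (hk : k ∈ Finset.Icc 1 (3 * n)) : x k ≤ 2 ↔ k ≤ 2 * n :=
    threshold_iff_le_card hx (· ≤ 2) (fun a b h h' => h.trans h') (by rw [himage, hT2]) hk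
  have hleft (i : ℕ) (h1 : 1 ≤ i) (h2 : i ≤ n) : x i < -2 :=
    (hlt2 i (Finset.mem_Icc.2 ⟨h1, by omega⟩)).2 h2
  have hright (i : ℕ) (h1 : 2 * n + 1 ≤ i) (h2 : i ≤ 3 * n) : 2 < x i := by
    have := hle2 i (Finset.mem_Icc.2 ⟨by omega, h2⟩)
    by_contra! h
    have := this.1 h
    omega
  have key := fun (A B M : Finset ℕ) => quadratureWeight_mul_prod_pos hn c hx horth1 hleft hright
    (A := A) (B := B) (M := M)
  have hmono (S : Finset ℕ) (k : ℕ) (hk : k ∈ Finset.Icc 1 (3 * n))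
      (hS : S ⊆ Finset.Icc 1 (3 * n)) : StrictMonoOn x (insert k S) :=
    hx.mono (Set.insert_subset (by simpa using hk) fun i hi => by simpa using hS hi)
  refine ⟨fun f hf => ?_, fun k h1 h2 => ?_, fun k h1 h2 => ?_, fun k h1 h2 => ?_⟩
  · rw [integral_eval_mul_scaledHermiteWeight hn]
    exact integral_eq_sum_quadratureWeight hn c hx horth1 (by omega)
  · have hk : k ∈ Finset.Icc 1 (3 * n) := Finset.mem_Icc.2 ⟨by omega, by omega⟩
    -- Test degree `n + n + 2(n - 1) = 4n - 2`; for an outer node it is `(n - 1) + n + 2n = 4n - 1`,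
    -- the largest allowed.
    have h := key (Finset.Icc 1 n) (Finset.Icc (2 * n + 1) (3 * n))
      ((Finset.Icc (n + 1) (2 * n)).erase k) subset_rfl subset_rfl
      (by rw [Finset.card_erase_of_mem (Finset.mem_Icc.2 ⟨h1, h2⟩)]; simp; omega) hk
      (by simp only [Finset.mem_Icc, Finset.mem_erase]; omega)
    refine pos_of_mul_pos_left h (mul_nonneg (mul_nonneg (Finset.prod_nonneg fun i hi => ?_)
      (Finset.prod_nonneg fun i hi => ?_)) (sq_nonneg _)) <;> rw [Finset.mem_Icc] at hi
    · linarith [hx (a := i) (b := k) ⟨by omega, by omega⟩ ⟨by omega, by omega⟩ (by omega)]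
    · linarith [hx (a := k) (b := i) ⟨by omega, by omega⟩ ⟨by omega, by omega⟩ (by omega)]
  · have hk : k ∈ Finset.Icc 1 (3 * n) := Finset.mem_Icc.2 ⟨by omega, by omega⟩
    have h := key ((Finset.Icc 1 n).erase k) (Finset.Icc (2 * n + 1) (3 * n))
      (Finset.Icc (n + 1) (2 * n)) (Finset.erase_subset _ _) subset_rfl
      (by rw [Finset.card_erase_of_mem (Finset.mem_Icc.2 ⟨h1, h2⟩)]; simp; omega) hk
      (by simp only [Finset.mem_Icc, Finset.mem_erase]; omega)
    have hA := (prod_sub_sign (hmono ((Finset.Icc 1 n).erase k) k hk fun i => by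
      simp only [Finset.mem_Icc, Finset.mem_erase]; omega) (Finset.notMem_erase _ _)).1
    have hfilter : ((Finset.Icc 1 n).erase k).filter (k < ·) = Finset.Ioc k n := by
      ext i; simp only [Finset.mem_filter, Finset.mem_erase, Finset.mem_Icc, Finset.mem_Ioc]; omega
    rw [hfilter, Nat.card_Ioc] at hA
    have hB : 0 ≤ ∏ i ∈ Finset.Icc (2 * n + 1) (3 * n), (x i - x k) :=
      Finset.prod_nonneg fun i hi => by
        rw [Finset.mem_Icc] at hi
        linarith [hleft k h1 h2, hright i hi.1 hi.2]
    -- A second copy of the product over the left nodes makes it a square; only the weight times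
    -- `(-1)^(n-k)` keeps a sign.
    have hs := mul_pos h hA
    have : (-1 : ℝ) ^ ((k : ℤ) - (n : ℤ)) = (-1) ^ (n - k) := by
      rw [← neg_sub, zpow_neg, ← Nat.cast_sub h2, zpow_natCast, ← inv_pow]
      norm_num
    rw [this]
    refine sign_eq_neg_one_pow (pos_of_mul_pos_left (a := _)
      (b := (∏ i ∈ (Finset.Icc 1 n).erase k, (x k - x i)) ^ 2 *
        (∏ i ∈ Finset.Icc (2 * n + 1) (3 * n), (x i - x k)) *
        (∏ i ∈ Finset.Icc (n + 1) (2 * n), (x k - x i)) ^ 2) ?_ (by positivity))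
    convert hs using 1
    ring
  · have hk : k ∈ Finset.Icc 1 (3 * n) := Finset.mem_Icc.2 ⟨by omega, by omega⟩
    have h := key (Finset.Icc 1 n) ((Finset.Icc (2 * n + 1) (3 * n)).erase k)
      (Finset.Icc (n + 1) (2 * n)) subset_rfl (Finset.erase_subset _ _)
      (by rw [Finset.card_erase_of_mem (Finset.mem_Icc.2 ⟨h1, h2⟩)]; simp; omega) hk
      (by simp only [Finset.mem_Icc, Finset.mem_erase]; omega)
    have hB := (prod_sub_sign (hmono ((Finset.Icc (2 * n + 1) (3 * n)).erase k) k hk fun i => by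
      simp only [Finset.mem_Icc, Finset.mem_erase]; omega) (Finset.notMem_erase _ _)).2
    have hfilter : ((Finset.Icc (2 * n + 1) (3 * n)).erase k).filter (· < k) =
        Finset.Ico (2 * n + 1) k := by
      ext i; simp only [Finset.mem_filter, Finset.mem_erase, Finset.mem_Icc, Finset.mem_Ico]; omega
    rw [hfilter, Nat.card_Ico] at hB
    have hA : 0 ≤ ∏ i ∈ Finset.Icc 1 n, (x k - x i) :=
      Finset.prod_nonneg fun i hi => by
        rw [Finset.mem_Icc] at hi
        linarith [hright k h1 h2, hleft i hi.1 hi.2]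
    have hs := mul_pos h hB
    have : (-1 : ℝ) ^ (k + 1) = (-1) ^ (k - (2 * n + 1)) := by
      conv_lhs => rw [show k + 1 = k - (2 * n + 1) + 2 * (n + 1) by omega, pow_add, pow_mul]
      simp
    rw [this]
    refine sign_eq_neg_one_pow (pos_of_mul_pos_left (a := _)
      (b := (∏ i ∈ (Finset.Icc (2 * n + 1) (3 * n)).erase k, (x i - x k)) ^ 2 *
        (∏ i ∈ Finset.Icc 1 n, (x k - x i)) *
        (∏ i ∈ Finset.Icc (n + 1) (2 * n), (x k - x i)) ^ 2) ?_ (by positivity))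
    convert hs using 1
    ring
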